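/- Let $N\ge 1$ and $n\in\{1,\dots,N\}$. Write the points of $L=\mathbb R^{2N}$ (with the Euclidean scalar product) as $\psi=(q,p)$, $q,p\in\mathbb R^N$. Let $e_n$ be the $n$-th standard basis vector of $\mathbb R^N$, $g_n=(0,e_n)\in L$, and let $\Delta_n$ be the $N\times N$ matrix whose only nonzero entry is a $1$ at position $(n,n)$. For a real symmetric positive definite $N\times N$ matrix $V$ and $\alpha\ge 0$ put $$H(\psi)=\tfrac12\sum_{i}p_i^2+\tfrac12\sum_{i,j}V(i,j)q_iq_j,\qquad A=\begin{pmatrix}0&E\\-V&-\alpha\Delta_n\end{pmatrix},$$ where $E$ is the unit matrix, $L_-=\{\psi\in L:\ H(e^{tA}\psi)\to0 \text{ as } t\to\infty\}$, and let $L_0$ be the orthogonal complement of $L_-$ in $L$. Let $\mathbf H_N$ be the manifold of all real symmetric positive definite $N\times N$ matrices (identified with the Hamiltonians $H$), with global coordinates $V(i,j)$, $i\le j$, and let $\mathbf H_N^{(+)}$ be the set of all $V\in\mathbf H_N$ with $\dim L_0>0$. 1. Let $\alpha>0$. Then $\mu(\mathbf H_N^{(+)})=0$ for every probability measure $\mu$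 on $\mathbf H_N$ that is absolutely continuous, i.e. absolutely continuous with respect to Lebesgue measure on $\mathbb R^{N(N+1)/2}$ in the above coordinates. Moreover, $\mathbf H_N^{(+)}=\{V\in\mathbf H_N:\ \det\Sigma(V)=0\}$, where $\Sigma(V)$ is the $N\times N$ matrix with columns $V^ke_n$, $k=0,\dots,N-1$, and $\det\Sigma(V)$ is a nonzero polynomial in the coordinates $V(i,j)$, $i\le j$. 2. Let $\alpha=0$, $\sigma>0$, $V\in\mathbf H_N$ and $\psi_0\in L$. There is a constant $C$ such that, if $w$ is a standard Brownian motion and $\psi(t)$, $t\ge0$, is the solution of $$d\psi=A\psi\,dt+\sigma g_n\,dw_t,\qquad \psi(0)=\psi_0,$$ then for all $t\ge0$ the variable $H(\psi(t))$ is integrable and $$\Big|\mathbf E\,H(\psi(t))-\frac{\sigma^2}{2}\,t\Big|\le C .$$ That is, $\mathbf E\,H(\psi(t))=\frac{\sigma^2}{2}t+O(1)$. -/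

import Mathlib

open MeasureTheory ProbabilityTheory Filter Topology
open scoped NNReal Matrix

noncomputable section

namespace LinHam

/-- The phase space `ℝ^{2N}` with its Euclidean scalar product: the coordinate `Sum.inl k` of `ψ`
is `q_k`, the coordinate `Sum.inr k` is `p_k`. -/
abbrev Phase (N : ℕ) : Type := EuclideanSpace ℝ (Fin N ⊕ Fin N)

/-- The set of all Hamiltonians, i.e. of all real symmetric positive definite `N × N` matrices
(`Matrix.PosDef` includes symmetry). -/
abbrev HN (N : ℕ) : Type := {V : Matrix (Fin N) (Fin N) ℝ // V.PosDef}

/-- The Borel sigma-algebra, for the topology of the entries. -/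
instance instMeasurableSpaceHN (N : ℕ) : MeasurableSpace (HN N) := borel (HN N)

instance instBorelSpaceHN (N : ℕ) : BorelSpace (HN N) := ⟨rfl⟩

/-- The Hamiltonian `H(q, p) = ½ ∑ p_i² + ½ ∑ V(i,j) q_i q_j`. -/
def energy {N : ℕ} (V : Matrix (Fin N) (Fin N) ℝ) (ψ : Phase N) : ℝ :=
  (1 / 2) * ∑ i, ψ (Sum.inr i) ^ 2
    + (1 / 2) * ∑ i, ∑ j, V i j * ψ (Sum.inl i) * ψ (Sum.inl j)

/-- The drift matrix `A = (0, E; -V, -D)` with `D = α Δ_n`, where `Δ_n` has the single nonzero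
entry `1` at the position `(n, n)`. -/
def drift {N : ℕ} (V : Matrix (Fin N) (Fin N) ℝ) (n : Fin N) (α : ℝ) :
    Matrix (Fin N ⊕ Fin N) (Fin N ⊕ Fin N) ℝ :=
  Matrix.fromBlocks 0 1 (-V) (-(α • Matrix.single n n (1 : ℝ)))

/-- The action of a `2N × 2N` matrix on the phase space. -/
def act {N : ℕ} (M : Matrix (Fin N ⊕ Fin N) (Fin N ⊕ Fin N) ℝ) (ψ : Phase N) : Phase N :=
  WithLp.toLp 2 (M *ᵥ ψ.ofLp)

/-- `g_n = (0, e_n)`. -/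
def kick {N : ℕ} (n : Fin N) : Phase N := EuclideanSpace.single (Sum.inr n) 1

/-- `L_- = {ψ : H(e^{tA} ψ) → 0 as t → ∞}`. -/
def LMinus {N : ℕ} (V : Matrix (Fin N) (Fin N) ℝ) (n : Fin N) (α : ℝ) : Set (Phase N) :=
  {ψ | Tendsto (fun t : ℝ => energy V (act (NormedSpace.exp (t • drift V n α)) ψ)) atTop (𝓝 0)}

/-- `L_0`, the orthogonal complement of `L_-`. -/
def LZero {N : ℕ} (V : Matrix (Fin N) (Fin N) ℝ) (n : Fin N) (α : ℝ) : Submodule ℝ (Phase N) :=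
  (Submodule.span ℝ (LMinus V n α))ᗮ

/-- The set of the Hamiltonians for which `dim L_0 > 0`. -/
def HPlus {N : ℕ} (n : Fin N) (α : ℝ) : Set (HN N) :=
  {V | 0 < Module.finrank ℝ (LZero V.1 n α)}

/-- Index set of the independent entries `V(i,j)`, `i ≤ j`, of a symmetric matrix. -/
abbrev UpperIdx (N : ℕ) : Type := {ij : Fin N × Fin N // ij.1 ≤ ij.2}

/-- The global chart `V ↦ (V(i,j))_{i ≤ j}` of the manifold of positive definite matrices, onto an
open subset of `ℝ^{N(N+1)/2}`. -/
def chart {N : ℕ} (V : HN N) : UpperIdx N → ℝ := fun ij => V.1 ij.1.1 ij.1.2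

theorem measurable_chart {N : ℕ} : Measurable (chart : HN N → UpperIdx N → ℝ) :=
  (continuous_pi fun ij : UpperIdx N =>
    (continuous_subtype_val (p := fun V : Matrix (Fin N) (Fin N) ℝ => V.PosDef)).matrix_elem ij.1.1 ij.1.2).measurable

/-- Absolute continuity of a measure on the manifold of positive definite matrices: in the global
chart it is absolutely continuous with respect to the Lebesgue measure of `ℝ^{N(N+1)/2}`. -/
def IsAbsCont {N : ℕ} (μ : Measure (HN N)) : Prop :=
  μ.map chart ≪ (volume : Measure (UpperIdx N → ℝ))

/-- The matrix whose columns are `V^k e_n`, `k = 0, …, N - 1`. -/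
def krylov {N : ℕ} (V : Matrix (Fin N) (Fin N) ℝ) (n : Fin N) : Matrix (Fin N) (Fin N) ℝ :=
  Matrix.of fun i k => ((V ^ (k : ℕ)) *ᵥ Pi.single n 1) i

/-- `ψ` is a solution, with (deterministic) initial vector `ψ₀`, of the stochastic differential
equation `dψ = A ψ dt + σ g_n dw`. The noise coefficient is constant, so the stochastic integral
`∫₀ᵗ σ g_n dw_s` is `σ w_t g_n`. -/
structure IsSolution {N : ℕ} {Ω : Type*} [MeasurableSpace Ω] (P : Measure Ω)
    (V : Matrix (Fin N) (Fin N) ℝ) (n : Fin N) (α σ : ℝ) (w : ℝ≥0 → Ω → ℝ) (ψ₀ : Phase N)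
    (ψ : ℝ≥0 → Ω → Phase N) : Prop where
  aemeasurable : ∀ t, AEMeasurable (ψ t) P
  continuous : ∀ᵐ ω ∂P, Continuous fun t => ψ t ω
  equation : ∀ᵐ ω ∂P, ∀ t : ℝ≥0,
    ψ t ω = ψ₀ + (∫ s in (0 : ℝ)..t, act (drift V n α) (ψ s.toNNReal ω))
      + (σ * w t ω) • kick n

end LinHam

end

/-!
The energy satisfies `d/dt H = -α p_n²` along `e^{tA}`, and everything in the first two claims
turns on whether `V` has an eigenvector `x` with `x_n = 0`.

If there is one, with eigenvalue `μ > 0`, then `μ⟨x, q⟩² + ⟨x, p⟩²` is conserved: the damping does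
not see this mode. On `L_-` it must vanish, so `(x, 0) ∈ L_0` (`inner_eq_zero_of_mem_LMinus`). Such
an eigenvector exists as soon as `det (V^k e_n)_k = 0` (`exists_eigenvector_apply_eq_zero`): in an
eigenbasis it is, up to sign, a Vandermonde determinant times the `n`-th coordinates of the basis.

If the determinant is nonzero, a trajectory along which the energy is constant for a while has
`p_n = 0` there, and by repeated differentiation `⟨V^k e_n, p⟩ = ⟨V^k e_n, V q⟩ = 0` for all `k`,
so that it is zero (`eq_zero_of_energy_act_exp_eq`). LaSalle's invariance principle then gives
`L_- = L` (`tendsto_energy_act_exp`).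

The determinant is a polynomial in the independent entries of `V`. It does not vanish identically
because it is nonzero at an arrow matrix (`krylovPoly_ne_zero`), and the zero set of a nonzero
polynomial is Lebesgue null by induction on the number of variables and Fubini's theorem.

For `α = 0`, Itô's formula would give `E H(ψ_t) = H(ψ_0) + σ² t / 2`, since the drift conserves the
energy. No stochastic integral is needed to see this. The process `φ = ψ - σ w g_n` is
differentiable in time, and the chain rule together with `p_n(φ_t) = p_n(0) - ∫₀ᵗ (V q_s)_n ds`
yields, path by path,
`H(ψ_t) = H(ψ_0) + σ ∫₀ᵗ (w_s - w_t) (V q_s)_n ds + σ w_t p_n(0) + σ² w_t² / 2`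
(`energy_eq_of_integral_eq`). By variation of constants `(V q_s)_n` is a deterministic term plus an
integral of `w` over `[0, s]`, hence uncorrelated with `w_s - w_t`, and the integral has mean zero
(`IsBrownianCovariance.integral_increment_mul_force`).
-/

noncomputable section

namespace LinHam

variable {N : ℕ}

/-! ### Energy and the linear flow -/

theorem act_apply (M : Matrix (Fin N ⊕ Fin N) (Fin N ⊕ Fin N) ℝ) (ψ : Phase N)
    (i : Fin N ⊕ Fin N) : act M ψ i = ∑ j, M i j * ψ j := rfl

theorem act_add (M : Matrix (Fin N ⊕ Fin N) (Fin N ⊕ Fin N) ℝ) (φ ψ : Phase N) :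
    act M (φ + ψ) = act M φ + act M ψ := by
  ext i; simp [act, Matrix.mulVec_add]

theorem act_smul (M : Matrix (Fin N ⊕ Fin N) (Fin N ⊕ Fin N) ℝ) (c : ℝ) (ψ : Phase N) :
    act M (c • ψ) = c • act M ψ := by
  ext i; simp [act, Matrix.mulVec_smul]

theorem act_mul (M M' : Matrix (Fin N ⊕ Fin N) (Fin N ⊕ Fin N) ℝ) (ψ : Phase N) :
    act (M * M') ψ = act M (act M' ψ) := by
  ext i; simp [act, Matrix.mulVec_mulVec]

theorem act_one (ψ : Phase N) : act 1 ψ = ψ := by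
  ext i; simp [act]

theorem continuous_act (M : Matrix (Fin N ⊕ Fin N) (Fin N ⊕ Fin N) ℝ) :
    Continuous (act M : Phase N → Phase N) := by
  unfold act
  fun_prop

@[simp]
theorem act_drift_inl (V : Matrix (Fin N) (Fin N) ℝ) (n : Fin N) (α : ℝ) (ψ : Phase N)
    (k : Fin N) : act (drift V n α) ψ (Sum.inl k) = ψ (Sum.inr k) := by
  simp [act_apply, drift, Matrix.one_apply]

@[simp]
theorem act_drift_inr (V : Matrix (Fin N) (Fin N) ℝ) (n : Fin N) (α : ℝ) (ψ : Phase N)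
    (k : Fin N) : act (drift V n α) ψ (Sum.inr k)
      = -(∑ j, V k j * ψ (Sum.inl j)) - α * (if k = n then ψ (Sum.inr n) else 0) := by
  simp [act_apply, drift, Matrix.single_apply, ite_and, eq_comm, sub_eq_add_neg]

section
attribute [local instance] Matrix.linftyOpNormedRing Matrix.linftyOpNormedAlgebra

/-- The matrix exponential solves the linear differential equation. -/
theorem hasDerivAt_exp_smul_matrix (M : Matrix (Fin N ⊕ Fin N) (Fin N ⊕ Fin N) ℝ) (t : ℝ) :
    HasDerivAt (fun t : ℝ => NormedSpace.exp (t • M)) (M * NormedSpace.exp (t • M)) t :=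
  hasDerivAt_exp_smul_const' M t

theorem hasDerivAt_exp_smul_apply (M : Matrix (Fin N ⊕ Fin N) (Fin N ⊕ Fin N) ℝ) (t : ℝ)
    (i j : Fin N ⊕ Fin N) :
    HasDerivAt (fun t : ℝ => NormedSpace.exp (t • M) i j)
      ((M * NormedSpace.exp (t • M)) i j) t := by
  have h := hasDerivAt_exp_smul_matrix M t
  exact ((Matrix.entryLinearMap ℝ ℝ i j).toContinuousLinearMap.hasFDerivAt.comp_hasDerivAt t h)

end

theorem hasDerivAt_phase {f : ℝ → Phase N} {f' : Phase N} {t : ℝ} :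
    HasDerivAt f f' t ↔ ∀ i, HasDerivAt (fun s => f s i) (f' i) t := by
  simp only [hasDerivAt_iff_hasFDerivAt, ← hasFDerivWithinAt_univ]
  rw [hasFDerivWithinAt_euclidean]
  exact Iff.rfl

theorem hasDerivAt_act_exp (M : Matrix (Fin N ⊕ Fin N) (Fin N ⊕ Fin N) ℝ) (ψ : Phase N) (t : ℝ) :
    HasDerivAt (fun t : ℝ => act (NormedSpace.exp (t • M)) ψ)
      (act M (act (NormedSpace.exp (t • M)) ψ)) t := by
  rw [← act_mul]
  refine hasDerivAt_phase.2 fun i => ?_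
  simp only [act_apply]
  exact HasDerivAt.fun_sum fun j _ => (hasDerivAt_exp_smul_apply M t i j).mul_const _

theorem act_exp_add (M : Matrix (Fin N ⊕ Fin N) (Fin N ⊕ Fin N) ℝ) (ψ : Phase N) (s t : ℝ) :
    act (NormedSpace.exp ((s + t) • M)) ψ
      = act (NormedSpace.exp (s • M)) (act (NormedSpace.exp (t • M)) ψ) := by
  rw [← act_mul, add_smul, Matrix.exp_add_of_commute]
  exact ((Commute.refl M).smul_left s).smul_right t

theorem act_exp_zero (M : Matrix (Fin N ⊕ Fin N) (Fin N ⊕ Fin N) ℝ) (ψ : Phase N) :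
    act (NormedSpace.exp ((0 : ℝ) • M)) ψ = ψ := by
  rw [zero_smul, NormedSpace.exp_zero, act_one]

theorem continuous_energy (V : Matrix (Fin N) (Fin N) ℝ) :
    Continuous (energy V : Phase N → ℝ) := by
  unfold energy
  fun_prop

theorem energy_smul (V : Matrix (Fin N) (Fin N) ℝ) (c : ℝ) (ψ : Phase N) :
    energy V (c • ψ) = c ^ 2 * energy V ψ := by
  simp only [energy, PiLp.smul_apply, smul_eq_mul, mul_add, Finset.mul_sum]
  congr 1
  · exact Finset.sum_congr rfl fun i _ => by ring
  · exact Finset.sum_congr rfl fun i _ => Finset.sum_congr rfl fun j _ => by ring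

/-- The differential of the energy along a curve. -/
theorem hasDerivAt_energy {V : Matrix (Fin N) (Fin N) ℝ} (hV : V.IsSymm) {f : ℝ → Phase N}
    {f' : Phase N} {t : ℝ} (h : HasDerivAt f f' t) :
    HasDerivAt (fun s => energy V (f s))
      (∑ i, f t (Sum.inr i) * f' (Sum.inr i)
        + ∑ i, (∑ j, V i j * f t (Sum.inl j)) * f' (Sum.inl i)) t := by
  have hc := hasDerivAt_phase.1 h
  have h1 : HasDerivAt (fun s => ∑ i, f s (Sum.inr i) ^ 2)
      (∑ i, 2 * (f t (Sum.inr i) * f' (Sum.inr i))) t := by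
    refine HasDerivAt.fun_sum fun i _ => ?_
    refine ((hc (Sum.inr i)).fun_pow 2).congr_deriv ?_
    norm_num
    ring
  have h2 : HasDerivAt (fun s => ∑ i, ∑ j, V i j * f s (Sum.inl i) * f s (Sum.inl j))
      (∑ i, ∑ j, (V i j * f' (Sum.inl i) * f t (Sum.inl j)
        + V i j * f t (Sum.inl i) * f' (Sum.inl j))) t :=
    HasDerivAt.fun_sum fun i _ => HasDerivAt.fun_sum fun j _ =>
      ((hc (Sum.inl i)).const_mul (V i j)).mul (hc (Sum.inl j))
  refine ((h1.const_mul (1 / 2)).add (h2.const_mul (1 / 2))).congr_deriv ?_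
  have h3 : ∑ i, ∑ j, V i j * f t (Sum.inl i) * f' (Sum.inl j)
      = ∑ i, ∑ j, V i j * f' (Sum.inl i) * f t (Sum.inl j) := by
    rw [Finset.sum_comm]
    refine Finset.sum_congr rfl fun i _ => Finset.sum_congr rfl fun j _ => ?_
    rw [hV.apply i j]; ring
  simp only [Finset.sum_add_distrib, h3, ← Finset.mul_sum, Finset.sum_mul]
  have h4 : ∑ i, ∑ j, V i j * f t (Sum.inl j) * f' (Sum.inl i)
      = ∑ i, ∑ j, V i j * f' (Sum.inl i) * f t (Sum.inl j) :=
    Finset.sum_congr rfl fun i _ => Finset.sum_congr rfl fun j _ => by ring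
  rw [h4]; ring

theorem energy_pos {V : Matrix (Fin N) (Fin N) ℝ} (hV : V.PosDef) {ψ : Phase N} (hψ : ψ ≠ 0) :
    0 < energy V ψ := by
  have hq : ∑ i, ∑ j, V i j * ψ (Sum.inl i) * ψ (Sum.inl j)
      = (fun i => ψ (Sum.inl i)) ⬝ᵥ (V *ᵥ fun i => ψ (Sum.inl i)) := by
    simp only [dotProduct, Matrix.mulVec, Finset.mul_sum]
    exact Finset.sum_congr rfl fun i _ => Finset.sum_congr rfl fun j _ => by ring
  have hp : 0 ≤ ∑ i, ψ (Sum.inr i) ^ 2 := Finset.sum_nonneg fun i _ => sq_nonneg _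
  unfold energy
  rw [hq]
  by_cases h : (fun i => ψ (Sum.inl i)) = 0
  · have hp' : 0 < ∑ i, ψ (Sum.inr i) ^ 2 := by
      refine lt_of_le_of_ne hp fun h0 => hψ ?_
      have := (Finset.sum_eq_zero_iff_of_nonneg fun i _ => sq_nonneg (ψ (Sum.inr i))).1 h0.symm
      ext i
      rcases i with i | i
      · exact congrFun h i
      · exact pow_eq_zero_iff two_ne_zero |>.1 (this i (Finset.mem_univ i))
    rw [h]
    simpa using hp'
  · have := hV.dotProduct_mulVec_pos h
    simp only [star_trivial] at this
    linarith

theorem energy_nonneg {V : Matrix (Fin N) (Fin N) ℝ} (hV : V.PosDef) (ψ : Phase N) :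
    0 ≤ energy V ψ := by
  rcases eq_or_ne ψ 0 with rfl | h
  · simp [energy]
  · exact (energy_pos hV h).le

/-- Coercivity of the energy, by compactness of the unit sphere. -/
theorem exists_mul_norm_sq_le_energy {V : Matrix (Fin N) (Fin N) ℝ} (hV : V.PosDef) :
    ∃ c : ℝ, 0 < c ∧ ∀ ψ : Phase N, c * ‖ψ‖ ^ 2 ≤ energy V ψ := by
  rcases (Metric.sphere (0 : Phase N) 1).eq_empty_or_nonempty with he | hne
  · refine ⟨1, one_pos, fun ψ => ?_⟩
    have hψ : ψ = 0 := by
      by_contra h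
      have : ‖ψ‖⁻¹ • ψ ∈ Metric.sphere (0 : Phase N) 1 := by
        simp [norm_smul, h]
      rw [he] at this
      exact this
    simp [hψ, energy]
  · obtain ⟨φ, hφ, hmin⟩ := (isCompact_sphere (0 : Phase N) 1).exists_isMinOn hne
      (continuous_energy V).continuousOn
    have hφ0 : φ ≠ 0 := by
      rintro rfl
      simp at hφ
    refine ⟨energy V φ, energy_pos hV hφ0, fun ψ => ?_⟩
    rcases eq_or_ne ψ 0 with rfl | h
    · simp [energy]
    · have hn : ‖ψ‖ ≠ 0 := norm_ne_zero_iff.2 h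
      have h1 : ‖ψ‖⁻¹ • ψ ∈ Metric.sphere (0 : Phase N) 1 := by
        simp [norm_smul, h]
      have h2 := hmin h1
      simp only [Set.mem_ofPred_eq, energy_smul] at h2
      calc energy V φ * ‖ψ‖ ^ 2 ≤ ‖ψ‖⁻¹ ^ 2 * energy V ψ * ‖ψ‖ ^ 2 := by gcongr
        _ = energy V ψ := by field_simp

/-! ### Eigenvectors that miss the damped coordinate -/

theorem pow_mulVec_of_mulVec_eq_smul {V : Matrix (Fin N) (Fin N) ℝ} {x : Fin N → ℝ} {μ : ℝ}
    (h : V *ᵥ x = μ • x) (k : ℕ) : (V ^ k) *ᵥ x = μ ^ k • x := by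
  induction k with
  | zero => simp
  | succ k ih => rw [pow_succ, ← Matrix.mulVec_mulVec, h, Matrix.mulVec_smul, ih, smul_smul,
      pow_succ, mul_comm]

theorem krylov_apply (V : Matrix (Fin N) (Fin N) ℝ) (n i k : Fin N) :
    krylov V n i k = (V ^ (k : ℕ)) i n := by
  rw [krylov, Matrix.of_apply, Matrix.mulVec_single_one, Matrix.col_apply]

theorem vecMul_krylov {V : Matrix (Fin N) (Fin N) ℝ} (hV : V.IsSymm) (n : Fin N) (y : Fin N → ℝ)
    (k : Fin N) : (y ᵥ* krylov V n) k = ((V ^ (k : ℕ)) *ᵥ y) n := by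
  have hk : (V ^ (k : ℕ)).IsSymm := hV.pow k
  simp only [Matrix.vecMul, dotProduct, krylov_apply, Matrix.mulVec]
  exact Finset.sum_congr rfl fun i _ => by rw [hk.apply n i, mul_comm]

/-- If the Krylov vectors `V^k e_n` are dependent, some eigenvector of `V` is orthogonal to `e_n`:
expanding a vanishing combination in an eigenbasis, either a basis vector has vanishing `n`-th
coordinate, or (Vandermonde) an eigenvalue is repeated and its eigenspace meets `e_n^⊥`. -/
theorem exists_eigenvector_apply_eq_zero {V : Matrix (Fin N) (Fin N) ℝ} (hV : V.IsHermitian)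
    {n : Fin N} (hdet : (krylov V n).det = 0) :
    ∃ (x : Fin N → ℝ) (μ : ℝ), x ≠ 0 ∧ V *ᵥ x = μ • x ∧ x n = 0 := by
  have hsymm : V.IsSymm := by simpa [Matrix.IsHermitian, Matrix.IsSymm] using hV
  obtain ⟨z, hz0, hz⟩ := Matrix.exists_mulVec_eq_zero_iff.2 hdet
  let u : Fin N → Fin N → ℝ := fun j => (hV.eigenvectorBasis j).ofLp
  have hu : ∀ j, V *ᵥ u j = hV.eigenvalues j • u j := fun j => hV.mulVec_eigenvectorBasis j
  have hu0 : ∀ j, u j ≠ 0 := fun j h =>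
    hV.eigenvectorBasis.orthonormal.ne_zero j ((WithLp.ofLp_eq_zero 2).1 h)
  by_cases hall : ∀ j, u j n ≠ 0
  · have hnot : ¬ Function.Injective hV.eigenvalues := by
      intro hinj
      refine hz0 (Matrix.eq_zero_of_mulVec_eq_zero
        (Matrix.det_vandermonde_ne_zero_iff.2 hinj) (funext fun j => ?_))
      have h1 : (u j ᵥ* krylov V n) ⬝ᵥ z = 0 := by
        rw [← Matrix.dotProduct_mulVec, hz, dotProduct_zero]
      have h2 : u j n * (Matrix.vandermonde hV.eigenvalues *ᵥ z) j = 0 := by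
        rw [← h1]
        simp only [Matrix.mulVec, dotProduct, Finset.mul_sum, Matrix.vandermonde_apply]
        refine Finset.sum_congr rfl fun k _ => ?_
        rw [vecMul_krylov hsymm, pow_mulVec_of_mulVec_eq_smul (hu j)]
        simp only [Pi.smul_apply, smul_eq_mul]
        ring
      exact (mul_eq_zero.1 h2).resolve_left (hall j)
    simp only [Function.Injective, not_forall] at hnot
    obtain ⟨i, j, hij, hne⟩ := hnot
    refine ⟨u j n • u i - u i n • u j, hV.eigenvalues i, fun h0 => ?_, ?_, ?_⟩
    · have h0' : u j n • hV.eigenvectorBasis i + (-u i n) • hV.eigenvectorBasis j = 0 := by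
        ext k
        have := congrFun h0 k
        simpa [u, sub_eq_add_neg] using this
      have h1 := congrArg (inner ℝ (hV.eigenvectorBasis i)) h0'
      simp [inner_add_right, inner_smul_right, hne] at h1
      exact hall j h1
    · rw [Matrix.mulVec_sub, Matrix.mulVec_smul, Matrix.mulVec_smul, hu, hu, ← hij, smul_sub,
        smul_comm, smul_comm (u i n)]
    · simp [mul_comm]
  · push Not at hall
    obtain ⟨j, hj⟩ := hall
    exact ⟨u j, _, hu0 j, hu j, hj⟩

/-! ### Damped systems: decay of the energy -/

theorem hasDerivAt_energy_act_exp {V : Matrix (Fin N) (Fin N) ℝ} (hV : V.IsSymm) (n : Fin N)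
    (α : ℝ) (ψ : Phase N) (t : ℝ) :
    HasDerivAt (fun t : ℝ => energy V (act (NormedSpace.exp (t • drift V n α)) ψ))
      (-α * act (NormedSpace.exp (t • drift V n α)) ψ (Sum.inr n) ^ 2) t := by
  refine (hasDerivAt_energy hV (hasDerivAt_act_exp (drift V n α) ψ t)).congr_deriv ?_
  simp only [act_drift_inl, act_drift_inr, mul_sub, mul_neg, Finset.sum_sub_distrib,
    Finset.sum_neg_distrib, mul_ite, mul_zero, Finset.sum_ite_eq', Finset.mem_univ, if_true]
  simp only [mul_comm (act _ ψ (Sum.inr _)) (∑ j, _)]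
  ring

theorem antitone_energy_act_exp {V : Matrix (Fin N) (Fin N) ℝ} (hV : V.IsSymm) (n : Fin N)
    {α : ℝ} (hα : 0 < α) (ψ : Phase N) :
    Antitone (fun t : ℝ => energy V (act (NormedSpace.exp (t • drift V n α)) ψ)) := by
  refine antitone_of_deriv_nonpos
    (fun t => (hasDerivAt_energy_act_exp hV n α ψ t).differentiableAt) fun t => ?_
  rw [(hasDerivAt_energy_act_exp hV n α ψ t).deriv]
  nlinarith [mul_nonneg hα.le (sq_nonneg
    (act (NormedSpace.exp (t • drift V n α)) ψ (Sum.inr n)))]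

theorem eq_zero_of_forall_pow_mulVec {V : Matrix (Fin N) (Fin N) ℝ} (hV : V.IsSymm) {n : Fin N}
    (hdet : (krylov V n).det ≠ 0) {y : Fin N → ℝ} (hy : ∀ k : ℕ, ((V ^ k) *ᵥ y) n = 0) : y = 0 :=
  Matrix.eq_zero_of_vecMul_eq_zero hdet (funext fun k => by rw [vecMul_krylov hV, hy]; rfl)

theorem hasDerivAt_eq_zero_of_forall_mem_Ioo {f : ℝ → ℝ} {f' a b t : ℝ} (h : HasDerivAt f f' t)
    (ht : t ∈ Set.Ioo a b) (hf : ∀ s ∈ Set.Ioo a b, f s = 0) : f' = 0 := by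
  have h0 : HasDerivAt f 0 t :=
    (hasDerivAt_const t (0 : ℝ)).congr_of_eventuallyEq
      (Filter.eventually_of_mem (Ioo_mem_nhds ht.1 ht.2) hf)
  exact h.unique h0

/-- Observability: if the energy does not drop during a unit of time, then `p_n` vanishes on the
interval `(0, 1)`; differentiating repeatedly, so do all `(V^k p)_n` and `(V^{k+1} q)_n`. -/
theorem eq_zero_of_energy_act_exp_eq {V : Matrix (Fin N) (Fin N) ℝ} (hV : V.PosDef) {n : Fin N}
    (hdet : (krylov V n).det ≠ 0) {α : ℝ} (hα : 0 < α) {ψ : Phase N}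
    (h : energy V (act (NormedSpace.exp ((1 : ℝ) • drift V n α)) ψ) = energy V ψ) : ψ = 0 := by
  have hsymm : V.IsSymm := by simpa [Matrix.IsHermitian, Matrix.IsSymm] using hV.isHermitian
  have hanti := antitone_energy_act_exp hsymm n hα ψ
  set z : ℝ → Phase N := fun t => act (NormedSpace.exp (t • drift V n α)) ψ with hz
  have hz0 : z 0 = ψ := act_exp_zero _ _
  have hz' : ∀ t, HasDerivAt z (act (drift V n α) (z t)) t := hasDerivAt_act_exp _ _
  have hconst : ∀ t ∈ Set.Ioo (0 : ℝ) 1, energy V (z t) - energy V ψ = 0 := by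
    intro t ht
    have h1 : energy V (z t) ≤ energy V (z 0) := hanti ht.1.le
    have h2 : energy V (z 1) ≤ energy V (z t) := hanti ht.2.le
    rw [hz0] at h1
    have h3 : energy V (z 1) = energy V ψ := h
    linarith
  have hp0 : ∀ t ∈ Set.Ioo (0 : ℝ) 1, z t (Sum.inr n) = 0 := by
    intro t ht
    have h1 := hasDerivAt_eq_zero_of_forall_mem_Ioo
      ((hasDerivAt_energy_act_exp hsymm n α ψ t).sub_const (energy V ψ)) ht hconst
    have h2 := (mul_eq_zero.1 h1).resolve_left (neg_ne_zero.2 hα.ne')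
    exact pow_eq_zero_iff two_ne_zero |>.1 h2
  have hdp : ∀ (k : ℕ), ∀ t ∈ Set.Ioo (0 : ℝ) 1,
      HasDerivAt (fun s => ((V ^ k) *ᵥ fun i => z s (Sum.inr i)) n)
        (-((V ^ (k + 1)) *ᵥ fun i => z t (Sum.inl i)) n) t := by
    intro k t ht
    have h1 : HasDerivAt (fun s => ((V ^ k) *ᵥ fun i => z s (Sum.inr i)) n)
        (∑ i, (V ^ k) n i * act (drift V n α) (z t) (Sum.inr i)) t := by
      simp only [Matrix.mulVec, dotProduct]
      exact HasDerivAt.fun_sum fun i _ =>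
        (hasDerivAt_phase.1 (hz' t) (Sum.inr i)).const_mul ((V ^ k) n i)
    refine h1.congr_deriv ?_
    simp only [act_drift_inr, hp0 t ht, ite_self, mul_zero, sub_zero, mul_neg,
      Finset.sum_neg_distrib]
    rw [pow_succ, ← Matrix.mulVec_mulVec]
    rfl
  have hdq : ∀ (k : ℕ), ∀ t : ℝ,
      HasDerivAt (fun s => ((V ^ k) *ᵥ fun i => z s (Sum.inl i)) n)
        (((V ^ k) *ᵥ fun i => z t (Sum.inr i)) n) t := by
    intro k t
    have h1 : HasDerivAt (fun s => ((V ^ k) *ᵥ fun i => z s (Sum.inl i)) n)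
        (∑ i, (V ^ k) n i * act (drift V n α) (z t) (Sum.inl i)) t := by
      simp only [Matrix.mulVec, dotProduct]
      exact HasDerivAt.fun_sum fun i _ =>
        (hasDerivAt_phase.1 (hz' t) (Sum.inl i)).const_mul ((V ^ k) n i)
    refine h1.congr_deriv ?_
    simp only [act_drift_inl]
    rfl
  have hq_of_hp : ∀ k : ℕ,
      (∀ t ∈ Set.Ioo (0 : ℝ) 1, ((V ^ k) *ᵥ fun i => z t (Sum.inr i)) n = 0) →
      ∀ t ∈ Set.Ioo (0 : ℝ) 1, ((V ^ (k + 1)) *ᵥ fun i => z t (Sum.inl i)) n = 0 :=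
    fun k hk t ht => neg_eq_zero.1 (hasDerivAt_eq_zero_of_forall_mem_Ioo (hdp k t ht) ht hk)
  have hp : ∀ k : ℕ, ∀ t ∈ Set.Ioo (0 : ℝ) 1,
      ((V ^ k) *ᵥ fun i => z t (Sum.inr i)) n = 0 := by
    intro k
    induction k with
    | zero => simpa using hp0
    | succ k ih =>
      exact fun t ht => hasDerivAt_eq_zero_of_forall_mem_Ioo (hdq (k + 1) t) ht (hq_of_hp k ih)
  -- Any interior time serves; there the state vanishes.
  have hmem : (1 / 2 : ℝ) ∈ Set.Ioo (0 : ℝ) 1 := by norm_num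
  have hP : (fun i => z (1 / 2) (Sum.inr i)) = 0 :=
    eq_zero_of_forall_pow_mulVec hsymm hdet fun k => hp k _ hmem
  have hQ : V *ᵥ (fun i => z (1 / 2) (Sum.inl i)) = 0 := by
    refine eq_zero_of_forall_pow_mulVec hsymm hdet fun k => ?_
    rw [Matrix.mulVec_mulVec, ← pow_succ]
    exact hq_of_hp k (hp k) _ hmem
  have hQ' : (fun i => z (1 / 2) (Sum.inl i)) = 0 :=
    Matrix.eq_zero_of_mulVec_eq_zero hV.det_pos.ne' hQ
  have hzero : z (1 / 2) = 0 := by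
    ext i
    rcases i with i | i
    · exact congrFun hQ' i
    · exact congrFun hP i
  -- The flow is invertible, so the initial state vanishes as well.
  have hback := act_exp_add (drift V n α) ψ (-(1 / 2)) (1 / 2)
  rw [neg_add_cancel, act_exp_zero] at hback
  change ψ = act _ (z (1 / 2)) at hback
  rw [hback, hzero]
  simpa using act_smul (NormedSpace.exp ((-(1 / 2) : ℝ) • drift V n α)) 0 0

/-- LaSalle's argument: the energy decreases to a limit, which it keeps along the trajectory of
any accumulation point. -/
theorem tendsto_energy_act_exp {V : Matrix (Fin N) (Fin N) ℝ} (hV : V.PosDef) {n : Fin N}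
    (hdet : (krylov V n).det ≠ 0) {α : ℝ} (hα : 0 < α) (ψ : Phase N) :
    Tendsto (fun t : ℝ => energy V (act (NormedSpace.exp (t • drift V n α)) ψ)) atTop (𝓝 0) := by
  have hsymm : V.IsSymm := by simpa [Matrix.IsHermitian, Matrix.IsSymm] using hV.isHermitian
  have hanti := antitone_energy_act_exp hsymm n hα ψ
  set z : ℝ → Phase N := fun t => act (NormedSpace.exp (t • drift V n α)) ψ with hz
  have hz0 : z 0 = ψ := act_exp_zero _ _
  obtain ⟨c, hc, hcoer⟩ := exists_mul_norm_sq_le_energy hV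
  have hlim := tendsto_atTop_ciInf hanti
    ⟨0, by rintro _ ⟨t, rfl⟩; exact energy_nonneg hV _⟩
  set h := ⨅ t, energy V (z t) with hh
  have hbdd : Bornology.IsBounded {φ : Phase N | energy V φ ≤ energy V ψ} := by
    refine (Metric.isBounded_closedBall (x := (0 : Phase N))
      (r := √(energy V ψ / c))).subset fun φ hφ => ?_
    rw [mem_closedBall_zero_iff]
    refine Real.le_sqrt_of_sq_le ?_
    rw [le_div_iff₀ hc, mul_comm]
    exact (hcoer φ).trans hφ
  obtain ⟨a, -, g, hg, hga⟩ := tendsto_subseq_of_bounded hbdd (x := fun k : ℕ => z k) fun k => by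
    have : energy V (z k) ≤ energy V (z 0) := hanti (Nat.cast_nonneg k)
    rwa [hz0] at this
  have hgt : Tendsto (fun k => ((g k : ℕ) : ℝ)) atTop atTop :=
    tendsto_natCast_atTop_atTop.comp hg.tendsto_atTop
  have h1 : energy V a = h :=
    tendsto_nhds_unique (((continuous_energy V).tendsto a).comp hga) (hlim.comp hgt)
  have h2 : energy V (act (NormedSpace.exp ((1 : ℝ) • drift V n α)) a) = h := by
    refine tendsto_nhds_unique ((((continuous_energy V).comp (continuous_act _)).tendsto a).comp
      hga) ((hlim.comp (tendsto_atTop_add_const_left atTop 1 hgt)).congr fun k => ?_)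
    simp only [Function.comp_apply, hz, act_exp_add]
  have ha : a = 0 := eq_zero_of_energy_act_exp_eq hV hdet hα (h2.trans h1.symm)
  have hh0 : h = 0 := by
    rw [← h1, ha]
    simp [energy]
  rwa [hh0] at hlim

/-- An eigenvector `x` of `V` with `x_n = 0` spans an undamped mode: `μ⟨x,q⟩² + ⟨x,p⟩²` is
conserved, so that `(x, 0)` is orthogonal to every decaying trajectory. -/
theorem inner_eq_zero_of_mem_LMinus {V : Matrix (Fin N) (Fin N) ℝ} (hV : V.PosDef) {n : Fin N}
    {α : ℝ} {x : Fin N → ℝ} {μ : ℝ} (hx0 : x ≠ 0) (hx : V *ᵥ x = μ • x) (hxn : x n = 0)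
    {ψ : Phase N} (hψ : ψ ∈ LMinus V n α) : ∑ i, x i * ψ (Sum.inl i) = 0 := by
  have hsymm : V.IsSymm := by simpa [Matrix.IsHermitian, Matrix.IsSymm] using hV.isHermitian
  have hμ : 0 < μ := by
    have h1 := hV.dotProduct_mulVec_pos hx0
    rw [hx, dotProduct_smul, smul_eq_mul, star_trivial] at h1
    exact pos_of_mul_pos_left h1 (Finset.sum_nonneg fun i _ => mul_self_nonneg _)
  set z : ℝ → Phase N := fun t => act (NormedSpace.exp (t • drift V n α)) ψ with hz
  have hz0 : z 0 = ψ := act_exp_zero _ _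
  have hz' : ∀ t, HasDerivAt z (act (drift V n α) (z t)) t := hasDerivAt_act_exp _ _
  obtain ⟨c, hc, hcoer⟩ := exists_mul_norm_sq_le_energy hV
  have hlim : Tendsto z atTop (𝓝 0) := by
    rw [tendsto_zero_iff_norm_tendsto_zero]
    have h1 : Tendsto (fun t => √(energy V (z t) / c)) atTop (𝓝 0) := by
      have := (Tendsto.div_const hψ c).sqrt
      simpa using this
    refine squeeze_zero (fun t => norm_nonneg _) (fun t => ?_) h1
    refine Real.le_sqrt_of_sq_le ?_
    rw [le_div_iff₀ hc, mul_comm]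
    exact hcoer _
  let F : Phase N → ℝ := fun φ =>
    μ * (∑ i, x i * φ (Sum.inl i)) ^ 2 + (∑ i, x i * φ (Sum.inr i)) ^ 2
  have hF : Continuous F := by fun_prop
  have hderiv : ∀ t, HasDerivAt (fun t => F (z t)) 0 t := by
    intro t
    have ha : HasDerivAt (fun s => ∑ i, x i * z s (Sum.inl i))
        (∑ i, x i * act (drift V n α) (z t) (Sum.inl i)) t :=
      HasDerivAt.fun_sum fun i _ => (hasDerivAt_phase.1 (hz' t) (Sum.inl i)).const_mul _
    have hb : HasDerivAt (fun s => ∑ i, x i * z s (Sum.inr i))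
        (∑ i, x i * act (drift V n α) (z t) (Sum.inr i)) t :=
      HasDerivAt.fun_sum fun i _ => (hasDerivAt_phase.1 (hz' t) (Sum.inr i)).const_mul _
    have hbd : ∑ i, x i * act (drift V n α) (z t) (Sum.inr i)
        = -(μ * ∑ i, x i * z t (Sum.inl i)) := by
      have h1 : ∀ j, ∑ i, x i * V i j = μ * x j := by
        intro j
        have := congrFun hx j
        simp only [Matrix.mulVec, dotProduct, Pi.smul_apply, smul_eq_mul] at this
        rw [← this]
        exact Finset.sum_congr rfl fun i _ => by rw [hsymm.apply j i, mul_comm]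
      simp only [act_drift_inr, mul_sub, mul_neg, Finset.sum_sub_distrib, Finset.sum_neg_distrib,
        mul_ite, mul_zero, Finset.sum_ite_eq', Finset.mem_univ, if_true, hxn, zero_mul, sub_zero,
        Finset.mul_sum]
      rw [Finset.sum_comm]
      congr 1
      refine Finset.sum_congr rfl fun j _ => ?_
      rw [← mul_assoc, ← h1, Finset.sum_mul]
      exact Finset.sum_congr rfl fun i _ => by ring
    refine (((ha.fun_pow 2).const_mul μ).add (hb.fun_pow 2)).congr_deriv ?_
    rw [hbd]
    simp only [act_drift_inl]
    norm_num
    ring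
  have hconst : ∀ t, F (z t) = F ψ := by
    intro t
    rw [← hz0]
    exact is_const_of_deriv_eq_zero (fun s => (hderiv s).differentiableAt)
      (fun s => (hderiv s).deriv) t 0
  have hF0 : F ψ = 0 := by
    refine tendsto_nhds_unique (tendsto_const_nhds (f := (atTop : Filter ℝ))) ?_
    have := (hF.tendsto 0).comp hlim
    simpa [Function.comp_def, hconst, F] using this
  have h1 : (∑ i, x i * ψ (Sum.inl i)) ^ 2 = 0 := by
    have h2 := sq_nonneg (∑ i, x i * ψ (Sum.inl i))
    have h3 := sq_nonneg (∑ i, x i * ψ (Sum.inr i))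
    have h4 : μ * (∑ i, x i * ψ (Sum.inl i)) ^ 2 + (∑ i, x i * ψ (Sum.inr i)) ^ 2 = 0 := hF0
    nlinarith [mul_nonneg hμ.le h2]
  exact pow_eq_zero_iff two_ne_zero |>.1 h1

theorem finrank_LZero_pos_iff {V : Matrix (Fin N) (Fin N) ℝ} (hV : V.PosDef) (n : Fin N)
    {α : ℝ} (hα : 0 < α) :
    0 < Module.finrank ℝ (LZero V n α) ↔ (krylov V n).det = 0 := by
  constructor
  · contrapose!
    intro hdet
    have h1 : LMinus V n α = Set.univ :=
      Set.eq_univ_of_forall fun ψ => tendsto_energy_act_exp hV hdet hα ψ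
    rw [LZero, h1, Submodule.span_univ, Submodule.top_orthogonal_eq_bot, finrank_bot]
  · intro hdet
    obtain ⟨x, μ, hx0, hx, hxn⟩ := exists_eigenvector_apply_eq_zero hV.isHermitian hdet
    let ξ : Phase N := WithLp.toLp 2 (Sum.elim x 0)
    have hξ : ξ ∈ LZero V n α := by
      have hle : Submodule.span ℝ (LMinus V n α) ≤ (ℝ ∙ ξ)ᗮ := by
        rw [Submodule.span_le]
        intro ψ hψ
        rw [SetLike.mem_coe, Submodule.mem_orthogonal_singleton_iff_inner_right]
        rw [← inner_eq_zero_of_mem_LMinus hV hx0 hx hxn hψ]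
        simp [ξ, PiLp.inner_apply, mul_comm]
      exact (Submodule.le_orthogonal_iff_le_orthogonal.1 hle)
        (Submodule.mem_span_singleton_self ξ)
    refine Module.finrank_pos_iff_exists_ne_zero.2 ⟨⟨ξ, hξ⟩, fun h => hx0 ?_⟩
    have h1 : ξ = 0 := congrArg Subtype.val h
    ext i
    exact congrArg (fun φ : Phase N => φ (Sum.inl i)) h1

/-! ### The determinant as a polynomial in the coordinates -/

/-- The zero set of a nonzero polynomial in `n` real variables is a Lebesgue null set: for almost
every value of the last `n - 1` variables the polynomial in the first one is nonzero. -/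
theorem volume_setOf_eval_eq_zero_fin (m : ℕ) (p : MvPolynomial (Fin m) ℝ) (hp : p ≠ 0) :
    volume {x : Fin m → ℝ | MvPolynomial.eval x p = 0} = 0 := by
  induction m with
  | zero =>
    have h : {x : Fin 0 → ℝ | MvPolynomial.eval x p = 0} = ∅ := by
      ext x
      rw [MvPolynomial.eq_C_of_isEmpty p] at hp ⊢
      simpa using hp
    rw [h, measure_empty]
  | succ m ih =>
    have hq : MvPolynomial.finSuccEquiv ℝ m p ≠ 0 := by simpa using hp
    obtain ⟨k, hk⟩ := Polynomial.ext_iff.not.1 hq |> not_forall.1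
    rw [Polynomial.coeff_zero] at hk
    let S : Set ((Fin m → ℝ) × ℝ) :=
      {z | MvPolynomial.eval (Fin.cons z.2 z.1 : Fin (m + 1) → ℝ) p = 0}
    have hS : MeasurableSet S := by
      refine (IsClosed.preimage ?_ (isClosed_singleton (x := (0 : ℝ)))).measurableSet
      refine (MvPolynomial.continuous_eval p).comp (continuous_pi fun i => ?_)
      refine Fin.cases ?_ (fun j => ?_) i
      · simpa using continuous_snd
      · simp only [Fin.cons_succ]
        fun_prop
    have hS0 : ((volume : Measure (Fin m → ℝ)).prod (volume : Measure ℝ)) S = 0 := by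
      refine (Measure.measure_prod_null hS).2 ?_
      have hae : ∀ᵐ s : Fin m → ℝ, MvPolynomial.eval s
          ((MvPolynomial.finSuccEquiv ℝ m p).coeff k) ≠ 0 := by
        rw [ae_iff]
        simpa using ih _ hk
      filter_upwards [hae] with s hs
      have hpoly : Polynomial.map (MvPolynomial.eval s) (MvPolynomial.finSuccEquiv ℝ m p) ≠ 0 := by
        intro h
        apply hs
        rw [← Polynomial.coeff_map, h, Polynomial.coeff_zero]
      have hfin := Polynomial.finite_setOfPred_isRoot hpoly
      refine Set.Finite.measure_zero (hfin.subset fun y hy => ?_) _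
      have hy' : MvPolynomial.eval (Fin.cons y s : Fin (m + 1) → ℝ) p = 0 := hy
      rwa [MvPolynomial.eval_eq_eval_mv_eval'] at hy'
    have hmp := (Measure.measurePreserving_swap (μ := (volume : Measure ℝ))
      (ν := (volume : Measure (Fin m → ℝ)))).comp
      (volume_preserving_piFinSuccAbove (fun _ : Fin (m + 1) => ℝ) 0)
    rw [← hmp.measure_preimage hS.nullMeasurableSet] at hS0
    convert hS0 using 2
    ext x
    simp only [Set.mem_ofPred_eq, Set.mem_preimage, S, Function.comp_apply, Prod.fst_swap,
      Prod.snd_swap]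
    -- The swap puts the first variable last; `Fin.cons` undoes the splitting.
    have hx : (Fin.cons (MeasurableEquiv.piFinSuccAbove (fun _ : Fin (m + 1) => ℝ) 0 x).1
        (MeasurableEquiv.piFinSuccAbove (fun _ : Fin (m + 1) => ℝ) 0 x).2 : Fin (m + 1) → ℝ)
        = x := by
      ext i
      refine Fin.cases ?_ (fun j => ?_) i <;> simp [Fin.tail]
    rw [hx]

theorem volume_setOf_eval_eq_zero {ι : Type*} [Fintype ι] (p : MvPolynomial ι ℝ) (hp : p ≠ 0) :
    volume {x : ι → ℝ | MvPolynomial.eval x p = 0} = 0 := by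
  let e := Fintype.equivFin ι
  have hq : MvPolynomial.rename e p ≠ 0 := fun h =>
    hp (MvPolynomial.rename_injective e e.injective (by rw [h, map_zero]))
  have h0 := volume_setOf_eval_eq_zero_fin _ _ hq
  have hmp := volume_measurePreserving_piCongrLeft (fun _ : Fin (Fintype.card ι) => ℝ) e
  have hmeas : MeasurableSet {x : Fin (Fintype.card ι) → ℝ |
      MvPolynomial.eval x (MvPolynomial.rename e p) = 0} :=
    ((isClosed_singleton (x := (0 : ℝ))).preimage (MvPolynomial.continuous_eval _)).measurableSet
  rw [← hmp.measure_preimage hmeas.nullMeasurableSet] at h0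
  convert h0 using 2
  ext x
  simp only [Set.mem_ofPred_eq, Set.mem_preimage, MvPolynomial.eval_rename]
  have hx : (MeasurableEquiv.piCongrLeft (fun _ : Fin (Fintype.card ι) => ℝ) e x) ∘ e = x := by
    ext i
    exact Equiv.piCongrLeft_apply_apply (fun _ : Fin (Fintype.card ι) => ℝ) e x i
  rw [hx]

/-- The index of the coordinate that holds the entry `(i, j)` of a symmetric matrix. -/
def upperIdx (i j : Fin N) : UpperIdx N := ⟨(min i j, max i j), min_le_max⟩

/-- The generic symmetric matrix, whose entries are the coordinate variables. -/
def genericSymm (N : ℕ) : Matrix (Fin N) (Fin N) (MvPolynomial (UpperIdx N) ℝ) :=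
  Matrix.of fun i j => MvPolynomial.X (upperIdx i j)

/-- The polynomial `det (V^k e_n)_k` in the independent entries of a symmetric matrix `V`. -/
def krylovPoly (n : Fin N) : MvPolynomial (UpperIdx N) ℝ :=
  (Matrix.of fun i k : Fin N =>
    (genericSymm N ^ (k : ℕ)) i n).det

theorem eval_krylovPoly (n : Fin N) {V : Matrix (Fin N) (Fin N) ℝ} (hV : V.IsSymm) :
    MvPolynomial.eval (fun ij : UpperIdx N => V ij.1.1 ij.1.2) (krylovPoly n)
      = (krylov V n).det := by
  set f := MvPolynomial.eval (fun ij : UpperIdx N => V ij.1.1 ij.1.2)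
  have hmap : f.mapMatrix (genericSymm N) = V := by
    ext i j
    simp only [RingHom.mapMatrix_apply, Matrix.map_apply, genericSymm, Matrix.of_apply, f,
      MvPolynomial.eval_X, upperIdx]
    rcases le_total i j with h | h
    · rw [min_eq_left h, max_eq_right h]
    · rw [min_eq_right h, max_eq_left h, hV.apply]
  rw [krylovPoly, RingHom.map_det]
  congr 1
  ext i k
  simp only [RingHom.mapMatrix_apply, Matrix.map_apply, Matrix.of_apply, krylov_apply]
  rw [← hmap, ← map_pow]
  rfl

/-- Non-vanishing is seen on an arrow matrix: distinct diagonal entries and ones in the `n`-th row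
and column. An eigenvector with `x_n = 0` could have only one nonzero entry, but its entries
sum to zero. -/
theorem krylovPoly_ne_zero (n : Fin N) : krylovPoly n ≠ 0 := by
  intro h0
  let V : Matrix (Fin N) (Fin N) ℝ := Matrix.of fun i j =>
    if i = j then (i : ℝ) else if i = n ∨ j = n then 1 else 0
  have hsymm : V.IsSymm := by
    ext i j
    simp only [Matrix.transpose_apply, V, Matrix.of_apply, eq_comm (a := j) (b := i),
      or_comm (a := j = n)]
    split_ifs with h
    · rw [h]
    · rfl
    · rfl
  have hherm : V.IsHermitian := by simpa [Matrix.IsHermitian, Matrix.IsSymm] using hsymm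
  have hdet : (krylov V n).det = 0 := by rw [← eval_krylovPoly n hsymm, h0, map_zero]
  obtain ⟨x, μ, hx0, hx, hxn⟩ := exists_eigenvector_apply_eq_zero hherm hdet
  have hrow : ∀ i, i ≠ n → (i : ℝ) * x i = μ * x i := by
    intro i hi
    have h1 := congrFun hx i
    simp only [Matrix.mulVec, dotProduct, Pi.smul_apply, smul_eq_mul] at h1
    rw [← h1, Finset.sum_eq_single i]
    · simp [V]
    · intro j _ hj
      by_cases hjn : j = n
      · rw [hjn, hxn, mul_zero]
      · simp [V, hj.symm, hi, hjn]
    · simp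
  -- Row `n` of `V x = μ x`, where the diagonal entry meets `x n = 0`.
  have hsum : ∑ j, x j = 0 := by
    have h1 := congrFun hx n
    simp only [Matrix.mulVec, dotProduct, Pi.smul_apply, smul_eq_mul, hxn, mul_zero] at h1
    rw [← h1]
    refine Finset.sum_congr rfl fun j _ => ?_
    by_cases hjn : j = n
    · rw [hjn, hxn, mul_zero]
    · simp [V, Ne.symm hjn]
  obtain ⟨i, hi⟩ := Function.ne_iff.1 hx0
  have hi' : x i ≠ 0 := hi
  have hin : i ≠ n := fun h => hi' (h ▸ hxn)
  have hμ : (i : ℝ) = μ := mul_right_cancel₀ hi' (hrow i hin)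
  apply hi'
  rw [← hsum, Finset.sum_eq_single i]
  · intro j _ hj
    by_contra hxj
    have hjn : j ≠ n := fun h => hxj (h ▸ hxn)
    have hμj : (j : ℝ) = μ := mul_right_cancel₀ hxj (hrow j hjn)
    have : (j : ℝ) = (i : ℝ) := hμj.trans hμ.symm
    exact hj (Fin.ext (by exact_mod_cast this))
  · simp

theorem eval_chart_krylovPoly (n : Fin N) (V : HN N) :
    MvPolynomial.eval (chart V) (krylovPoly n) = (krylov V.1 n).det :=
  eval_krylovPoly n (by simpa [Matrix.IsHermitian, Matrix.IsSymm] using V.2.isHermitian)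

theorem HPlus_eq (n : Fin N) {α : ℝ} (hα : 0 < α) :
    HPlus n α = {V : HN N | MvPolynomial.eval (chart V) (krylovPoly n) = 0} := by
  ext V
  rw [Set.mem_ofPred_eq, eval_chart_krylovPoly, ← finrank_LZero_pos_iff V.2 n hα]
  rfl

theorem measure_HPlus_eq_zero (n : Fin N) {α : ℝ} (hα : 0 < α) {μ : Measure (HN N)}
    (hμ : IsAbsCont μ) : μ (HPlus n α) = 0 := by
  have h1 := hμ (volume_setOf_eval_eq_zero _ (krylovPoly_ne_zero n))
  rw [Measure.map_apply measurable_chart] at h1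
  · rw [HPlus_eq n hα]
    exact h1
  · exact ((isClosed_singleton (x := (0 : ℝ))).preimage
      (MvPolynomial.continuous_eval _)).measurableSet

/-! ### The undamped equation with additive noise, path by path -/

/-- The quantity `(V q)_n`: minus the potential force that acts on the `n`-th particle. -/
def force (V : Matrix (Fin N) (Fin N) ℝ) (n : Fin N) (φ : Phase N) : ℝ :=
  ∑ j, V n j * φ (Sum.inl j)

theorem force_add (V : Matrix (Fin N) (Fin N) ℝ) (n : Fin N) (φ ψ : Phase N) :
    force V n (φ + ψ) = force V n φ + force V n ψ := by
  simp [force, mul_add, Finset.sum_add_distrib]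

theorem force_smul (V : Matrix (Fin N) (Fin N) ℝ) (n : Fin N) (c : ℝ) (φ : Phase N) :
    force V n (c • φ) = c * force V n φ := by
  simp only [force, PiLp.smul_apply, smul_eq_mul, Finset.mul_sum]
  exact Finset.sum_congr rfl fun j _ => by ring

theorem force_kick (V : Matrix (Fin N) (Fin N) ℝ) (n : Fin N) : force V n (kick n) = 0 := by
  simp [force, kick]

theorem continuous_force (V : Matrix (Fin N) (Fin N) ℝ) (n : Fin N) :
    Continuous (force V n) := by
  unfold force
  fun_prop

theorem hasDerivAt_force (V : Matrix (Fin N) (Fin N) ℝ) (n : Fin N) {f : ℝ → Phase N}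
    {f' : Phase N} {t : ℝ} (h : HasDerivAt f f' t) :
    HasDerivAt (fun s => force V n (f s)) (force V n f') t :=
  HasDerivAt.fun_sum fun j _ => (hasDerivAt_phase.1 h (Sum.inl j)).const_mul (V n j)

theorem energy_add_smul_kick (V : Matrix (Fin N) (Fin N) ℝ) (n : Fin N) (c : ℝ) (φ : Phase N) :
    energy V (φ + c • kick n) = energy V φ + c * φ (Sum.inr n) + c ^ 2 / 2 := by
  have h1 : ∀ i, (φ + c • kick n) (Sum.inl i) = φ (Sum.inl i) := by
    intro i
    simp [kick]
  have h2 : ∀ i, (φ + c • kick n) (Sum.inr i) ^ 2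
      = φ (Sum.inr i) ^ 2 + if i = n then 2 * c * φ (Sum.inr n) + c ^ 2 else 0 := by
    intro i
    by_cases hi : i = n
    · subst hi
      simp [kick]
      ring
    · simp [kick, hi]
  unfold energy
  simp only [h1, h2, Finset.sum_add_distrib, Finset.sum_ite_eq', Finset.mem_univ, if_true]
  ring

section
attribute [local instance] Matrix.linftyOpNormedRing Matrix.linftyOpNormedAlgebra

theorem hasDerivAt_exp_smul_apply' (M : Matrix (Fin N ⊕ Fin N) (Fin N ⊕ Fin N) ℝ) (t : ℝ)
    (i j : Fin N ⊕ Fin N) :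
    HasDerivAt (fun t : ℝ => NormedSpace.exp (t • M) i j)
      ((NormedSpace.exp (t • M) * M) i j) t := by
  have h : HasDerivAt (fun t : ℝ => NormedSpace.exp (t • M)) (NormedSpace.exp (t • M) * M) t :=
    hasDerivAt_exp_smul_const M t
  exact ((Matrix.entryLinearMap ℝ ℝ i j).toContinuousLinearMap.hasFDerivAt.comp_hasDerivAt t h)

end

/-- The derivative in the variation of constants formula. -/
theorem hasDerivAt_act_exp_sub (M : Matrix (Fin N ⊕ Fin N) (Fin N ⊕ Fin N) ℝ) (t : ℝ)
    {f : ℝ → Phase N} {f' : Phase N} {u : ℝ} (hf : HasDerivAt f f' u) :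
    HasDerivAt (fun u => act (NormedSpace.exp ((t - u) • M)) (f u))
      (act (NormedSpace.exp ((t - u) • M)) (f' - act M (f u))) u := by
  rw [show f' - act M (f u) = f' + (-1 : ℝ) • act M (f u) by rw [neg_one_smul, sub_eq_add_neg],
    act_add, act_smul, ← act_mul]
  refine hasDerivAt_phase.2 fun i => ?_
  have h1 : HasDerivAt (fun u => ∑ j, NormedSpace.exp ((t - u) • M) i j * f u j)
      (∑ j, (-(NormedSpace.exp ((t - u) • M) * M) i j * f u j
        + NormedSpace.exp ((t - u) • M) i j * f' j)) u := by
    refine HasDerivAt.fun_sum fun j _ => ?_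
    have h2 := (hasDerivAt_exp_smul_apply' M (t - u) i j).comp_const_sub t u
    exact h2.mul (hasDerivAt_phase.1 hf j)
  refine h1.congr_deriv ?_
  simp only [PiLp.add_apply, PiLp.smul_apply, act_apply, smul_eq_mul, Finset.sum_add_distrib,
    neg_mul, Finset.sum_neg_distrib, one_mul]
  ring

/-- The rate of change at time `r` of the force `(V q)_n` along the undamped trajectory that
starts from the unit kick `(0, e_n)`. -/
def kernel (V : Matrix (Fin N) (Fin N) ℝ) (n : Fin N) (r : ℝ) : ℝ :=
  force V n (act (NormedSpace.exp (r • drift V n 0)) (act (drift V n 0) (kick n)))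

theorem continuous_force_act_exp (V : Matrix (Fin N) (Fin N) ℝ) (n : Fin N) (φ : Phase N) :
    Continuous fun r : ℝ => force V n (act (NormedSpace.exp (r • drift V n 0)) φ) :=
  (continuous_force V n).comp (continuous_iff_continuousAt.2 fun r =>
    (hasDerivAt_act_exp (drift V n 0) φ r).continuousAt)

theorem continuous_kernel (V : Matrix (Fin N) (Fin N) ℝ) (n : Fin N) : Continuous (kernel V n) :=
  continuous_force_act_exp V n _

/-- The energy along a solution of the undamped equation driven by a continuous signal `b`.
The last factor under the integral over `s` is `(V q_s)_n`, expressed through `b` on `[0, s]` by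
variation of constants; it is multiplied by an increment of `b` after the time `s`. -/
theorem energy_eq_of_integral_eq {V : Matrix (Fin N) (Fin N) ℝ} (hV : V.IsSymm) (n : Fin N)
    {σ : ℝ} {ψ₀ : Phase N} {y : ℝ → Phase N} {b : ℝ → ℝ} (hyc : Continuous y)
    (hbc : Continuous b)
    (hy : ∀ t, 0 ≤ t → y t = ψ₀ + (∫ s in (0 : ℝ)..t, act (drift V n 0) (y s))
      + (σ * b t) • kick n) {t : ℝ} (ht : 0 ≤ t) :
    energy V (y t) = energy V ψ₀ + σ * (∫ s in (0 : ℝ)..t, (b s - b t) *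
        (force V n (act (NormedSpace.exp (s • drift V n 0)) ψ₀)
          + σ * ∫ u in (0 : ℝ)..s, b u * kernel V n (s - u)))
      + σ * b t * ψ₀ (Sum.inr n) + σ ^ 2 / 2 * b t ^ 2 := by
  set M := drift V n 0 with hM
  -- `Φ = y - σ b g_n` is differentiable although `y` is not.
  let Φ : ℝ → Phase N := fun t => ψ₀ + ∫ s in (0 : ℝ)..t, act M (y s)
  have hMc : Continuous fun s => act M (y s) := (continuous_act M).comp hyc
  have hΦ : ∀ t, HasDerivAt Φ (act M (y t)) t := fun t =>
    (intervalIntegral.integral_hasDerivAt_right (hMc.intervalIntegrable _ _)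
      hMc.stronglyMeasurable.stronglyMeasurableAtFilter hMc.continuousAt).const_add ψ₀
  have hΦ0 : Φ 0 = ψ₀ := by simp [Φ]
  have hyΦ : ∀ t, 0 ≤ t → y t = Φ t + (σ * b t) • kick n := hy
  have hforce : ∀ t, 0 ≤ t → force V n (y t) = force V n (Φ t) := by
    intro t ht
    rw [hyΦ t ht, force_add, force_smul, force_kick, mul_zero, add_zero]
  -- variation of constants
  have hduhamel : ∀ s, 0 ≤ s → force V n (y s)
      = force V n (act (NormedSpace.exp (s • M)) ψ₀)
        + σ * ∫ u in (0 : ℝ)..s, b u * kernel V n (s - u) := by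
    intro s hs
    have h1 : ∫ u in (0 : ℝ)..s, σ * (b u * kernel V n (s - u))
        = force V n (act (NormedSpace.exp ((s - s) • M)) (Φ s))
          - force V n (act (NormedSpace.exp ((s - 0) • M)) (Φ 0)) := by
      refine intervalIntegral.integral_eq_sub_of_hasDerivAt
        (f := fun u => force V n (act (NormedSpace.exp ((s - u) • M)) (Φ u))) (fun u hu => ?_) ?_
      · rw [Set.uIcc_of_le hs] at hu
        refine (hasDerivAt_force V n (hasDerivAt_act_exp_sub M s (hΦ u))).congr_deriv ?_
        rw [hyΦ u hu.1, act_add, add_sub_cancel_left, act_smul, act_smul, force_smul, kernel]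
        ring
      · refine Continuous.intervalIntegrable ?_ _ _
        exact continuous_const.mul (hbc.mul
          ((continuous_kernel V n).comp (continuous_const.sub continuous_id)))
    rw [hforce s hs]
    rw [intervalIntegral.integral_const_mul, sub_self, sub_zero, hΦ0, act_exp_zero] at h1
    rw [h1]
    ring
  have hfc : Continuous fun s => force V n (y s) := (continuous_force V n).comp hyc
  have hpn : Φ t (Sum.inr n) = ψ₀ (Sum.inr n) - ∫ s in (0 : ℝ)..t, force V n (y s) := by
    have h1 : ∫ s in (0 : ℝ)..t, -force V n (y s) = Φ t (Sum.inr n) - Φ 0 (Sum.inr n) := by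
      refine intervalIntegral.integral_eq_sub_of_hasDerivAt
        (f := fun s => Φ s (Sum.inr n)) (fun s _ => ?_) (hfc.neg.intervalIntegrable _ _)
      refine (hasDerivAt_phase.1 (hΦ s) (Sum.inr n)).congr_deriv ?_
      simp [hM, force]
    rw [intervalIntegral.integral_neg, hΦ0] at h1
    linarith
  have hen : energy V (Φ t) = energy V ψ₀ + ∫ s in (0 : ℝ)..t, σ * b s * force V n (y s) := by
    have h1 : ∫ s in (0 : ℝ)..t, σ * b s * force V n (y s)
        = energy V (Φ t) - energy V (Φ 0) := by
      refine intervalIntegral.integral_eq_sub_of_hasDerivAt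
        (f := fun s => energy V (Φ s)) (fun s hs => ?_)
        (((continuous_const.mul hbc).mul hfc).intervalIntegrable _ _)
      rw [Set.uIcc_of_le ht] at hs
      refine (hasDerivAt_energy hV (hΦ s)).congr_deriv ?_
      rw [hforce s hs.1, hyΦ s hs.1]
      have hr : ∀ i, act M (Φ s + (σ * b s) • kick n) (Sum.inr i)
          = -∑ j, V i j * Φ s (Sum.inl j) := by
        intro i
        simp [hM, kick]
      have hl : ∀ i, act M (Φ s + (σ * b s) • kick n) (Sum.inl i)
          = Φ s (Sum.inr i) + if i = n then σ * b s else 0 := by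
        intro i
        by_cases hi : i = n
        · simp [hM, kick, hi]
        · simp [hM, kick, hi]
      simp only [hr, hl, mul_neg, mul_add, Finset.sum_add_distrib, Finset.sum_neg_distrib,
        mul_ite, mul_zero, Finset.sum_ite_eq', Finset.mem_univ, if_true]
      rw [force, Finset.sum_congr rfl fun i _ =>
        mul_comm (Φ s (Sum.inr i)) (∑ j, V i j * Φ s (Sum.inl j))]
      ring
    rw [hΦ0] at h1
    linarith
  have hint : ∫ s in (0 : ℝ)..t, (b s - b t) *
        (force V n (act (NormedSpace.exp (s • M)) ψ₀)
          + σ * ∫ u in (0 : ℝ)..s, b u * kernel V n (s - u))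
      = (∫ s in (0 : ℝ)..t, b s * force V n (y s)) - b t * ∫ s in (0 : ℝ)..t, force V n (y s) := by
    have hbf : Continuous fun s => b s * force V n (y s) := hbc.mul hfc
    have hcf : Continuous fun s => b t * force V n (y s) := continuous_const.mul hfc
    rw [← intervalIntegral.integral_const_mul, ← intervalIntegral.integral_sub
      (hbf.intervalIntegrable _ _) (hcf.intervalIntegrable _ _)]
    refine intervalIntegral.integral_congr fun s hs => ?_
    rw [Set.uIcc_of_le ht] at hs
    simp only [← hduhamel s hs.1]
    ring
  have hσ : ∫ s in (0 : ℝ)..t, σ * b s * force V n (y s)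
      = σ * ∫ s in (0 : ℝ)..t, b s * force V n (y s) := by
    rw [← intervalIntegral.integral_const_mul]
    simp only [mul_assoc]
  rw [hyΦ t ht, energy_add_smul_kick, hen, hpn, hint, hσ]
  ring

/-! ### Mean energy of the stochastic equation -/

/-- Fubini for pathwise interval integrals of continuous centered processes that are
bounded in mean. -/
theorem integral_intervalIntegral_eq_zero {Ω : Type*} [MeasurableSpace Ω] {P : Measure Ω}
    [IsProbabilityMeasure P] {F : ℝ → Ω → ℝ} (hc : ∀ ω, Continuous fun s => F s ω)
    (hm : ∀ s, Measurable (F s)) {t K : ℝ} (ht : 0 ≤ t)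
    (hi : ∀ s ∈ Set.Icc 0 t, Integrable (F s) P)
    (hK : ∀ s ∈ Set.Icc 0 t, ∫ ω, |F s ω| ∂P ≤ K)
    (h0 : ∀ s ∈ Set.Icc 0 t, ∫ ω, F s ω ∂P = 0) :
    Integrable (fun ω => ∫ s in (0 : ℝ)..t, F s ω) P ∧ ∫ ω, (∫ s in (0 : ℝ)..t, F s ω) ∂P = 0 ∧
      ∫ ω, |∫ s in (0 : ℝ)..t, F s ω| ∂P ≤ K * t := by
  have hmeas : Measurable (Function.uncurry F) :=
    measurable_uncurry_of_continuous_of_measurable hc hm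
  simp only [intervalIntegral.integral_of_le ht]
  set ν : Measure ℝ := volume.restrict (Set.Ioc 0 t) with hν
  have hmem : ∀ᵐ s ∂ν, s ∈ Set.Icc 0 t := by
    filter_upwards [ae_restrict_mem measurableSet_Ioc] with s hs using Set.Ioc_subset_Icc_self hs
  have hint : Integrable (Function.uncurry F) (ν.prod P) := by
    refine (integrable_prod_iff hmeas.aestronglyMeasurable).2
      ⟨hmem.mono fun s hs => hi s hs, ?_⟩
    refine Integrable.of_bound
      hmeas.stronglyMeasurable.norm.integral_prod_right'.aestronglyMeasurable K
      (hmem.mono fun s hs => ?_)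
    rw [Real.norm_of_nonneg (integral_nonneg fun ω => norm_nonneg _)]
    exact hK s hs
  have h1 : Integrable (fun ω => ∫ s, F s ω ∂ν) P := hint.integral_prod_right
  refine ⟨h1, ?_, ?_⟩
  · rw [← integral_integral_swap hint]
    exact integral_eq_zero_of_ae (hmem.mono fun s hs => h0 s hs)
  · have hint' : Integrable (Function.uncurry fun s ω => |F s ω|) (ν.prod P) := hint.abs
    calc ∫ ω, |∫ s, F s ω ∂ν| ∂P ≤ ∫ ω, ∫ s, |F s ω| ∂ν ∂P :=
          integral_mono h1.abs hint'.integral_prod_right fun ω => abs_integral_le_integral_abs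
      _ = ∫ s, ∫ ω, |F s ω| ∂P ∂ν := (integral_integral_swap hint').symm
      _ ≤ ∫ _, K ∂ν := integral_mono_ae hint'.integral_prod_left (integrable_const K)
          (hmem.mono fun s hs => hK s hs)
      _ = K * t := by
        simp [hν, ht, mul_comm]

/-- A process on the real line with continuous paths that has the first and second moments of a
Brownian motion on the half-line `s ≥ 0`. -/
structure IsBrownianCovariance {Ω : Type*} [MeasurableSpace Ω] (W : ℝ → Ω → ℝ) (P : Measure Ω) :
    Prop where
  measurable : ∀ s, Measurable (W s)
  continuous : ∀ ω, Continuous fun s => W s ω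
  integrable : ∀ s, 0 ≤ s → Integrable (W s) P
  integrable_mul : ∀ s t, 0 ≤ s → 0 ≤ t → Integrable (fun ω => W s ω * W t ω) P
  integral_eq : ∀ s, 0 ≤ s → ∫ ω, W s ω ∂P = 0
  integral_mul : ∀ s t, 0 ≤ s → 0 ≤ t → ∫ ω, W s ω * W t ω ∂P = min s t

namespace IsBrownianCovariance

variable {Ω : Type*} [MeasurableSpace Ω] {W : ℝ → Ω → ℝ} {P : Measure Ω}

theorem integrable_sq (hW : IsBrownianCovariance W P) {s : ℝ} (hs : 0 ≤ s) :
    Integrable (fun ω => W s ω ^ 2) P := by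
  simpa only [pow_two] using hW.integrable_mul s s hs hs

theorem integral_sq (hW : IsBrownianCovariance W P) {s : ℝ} (hs : 0 ≤ s) :
    ∫ ω, W s ω ^ 2 ∂P = s := by
  simpa only [pow_two, min_self] using hW.integral_mul s s hs hs

/-- The increment `W_s - W_t` over the future of `s` is orthogonal to `W_u`, `u ≤ s`, hence to
every integral of `W` over `[0, s]`. -/
theorem integral_increment_mul_primitive [IsProbabilityMeasure P]
    (hW : IsBrownianCovariance W P) {k : ℝ → ℝ} (hk : Continuous k) {s t K : ℝ}
    (hs : 0 ≤ s) (hst : s ≤ t) (hK : ∀ r ∈ Set.Icc 0 t, |k r| ≤ K) :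
    Integrable (fun ω => ∫ u in (0 : ℝ)..s, (W s ω - W t ω) * W u ω * k (s - u)) P ∧
      ∫ ω, (∫ u in (0 : ℝ)..s, (W s ω - W t ω) * W u ω * k (s - u)) ∂P = 0 ∧
      ∫ ω, |∫ u in (0 : ℝ)..s, (W s ω - W t ω) * W u ω * k (s - u)| ∂P ≤ K * (3 * t) * s := by
  have ht : 0 ≤ t := hs.trans hst
  have hi : ∀ u ∈ Set.Icc 0 s, Integrable (fun ω => (W s ω - W t ω) * W u ω) P := by
    intro u hu
    simp only [sub_mul]
    exact (hW.integrable_mul s u hs hu.1).sub (hW.integrable_mul t u ht hu.1)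
  have hcont : ∀ ω, Continuous fun u => (W s ω - W t ω) * W u ω * k (s - u) := fun ω =>
    (continuous_const.mul (hW.continuous ω)).mul (hk.comp (continuous_const.sub continuous_id))
  refine integral_intervalIntegral_eq_zero hcont
    (fun u => (((hW.measurable s).sub (hW.measurable t)).mul (hW.measurable u)).mul_const _) hs
    (fun u hu => (hi u hu).mul_const _) (fun u hu => ?_) (fun u hu => ?_)
  · have hku : |k (s - u)| ≤ K := hK _ ⟨by linarith [hu.2], by linarith [hu.1]⟩
    have hst2 : Integrable (fun ω => W s ω ^ 2 + W t ω ^ 2) P :=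
      (hW.integrable_sq hs).add (hW.integrable_sq ht)
    have hsq : ∫ ω, |(W s ω - W t ω) * W u ω| ∂P ≤ 3 * t := by
      calc ∫ ω, |(W s ω - W t ω) * W u ω| ∂P
          ≤ ∫ ω, (W s ω ^ 2 + W t ω ^ 2 + W u ω ^ 2) ∂P := by
            refine integral_mono (hi u hu).abs
              (hst2.add (hW.integrable_sq hu.1)) fun ω => abs_le.2 ⟨?_, ?_⟩
            · nlinarith [sq_nonneg (W s ω - W t ω + W u ω), sq_nonneg (W s ω + W t ω),
                sq_nonneg (W u ω)]
            · nlinarith [sq_nonneg (W s ω - W t ω - W u ω), sq_nonneg (W s ω + W t ω),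
                sq_nonneg (W u ω)]
        _ = s + t + u := by
            rw [integral_add hst2 (hW.integrable_sq hu.1),
              integral_add (hW.integrable_sq hs) (hW.integrable_sq ht),
              hW.integral_sq hs, hW.integral_sq ht, hW.integral_sq hu.1]
        _ ≤ 3 * t := by linarith [hu.2]
    simp only [abs_mul _ (k (s - u)), integral_mul_const]
    rw [mul_comm]
    exact mul_le_mul hku hsq (integral_nonneg fun ω => abs_nonneg _) ((abs_nonneg _).trans hku)
  · rw [integral_mul_const]
    simp only [sub_mul]
    rw [integral_sub (hW.integrable_mul s u hs hu.1) (hW.integrable_mul t u ht hu.1),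
      hW.integral_mul s u hs hu.1, hW.integral_mul t u ht hu.1, min_eq_right hu.2,
      min_eq_right (hu.2.trans hst), sub_self, zero_mul]

theorem integral_increment_mul_force [IsProbabilityMeasure P]
    (hW : IsBrownianCovariance W P) {a k : ℝ → ℝ} (ha : Continuous a) (hk : Continuous k)
    (σ : ℝ) {t : ℝ} (ht : 0 ≤ t) :
    Integrable (fun ω => ∫ s in (0 : ℝ)..t, (W s ω - W t ω) *
        (a s + σ * ∫ u in (0 : ℝ)..s, W u ω * k (s - u))) P ∧
      ∫ ω, (∫ s in (0 : ℝ)..t, (W s ω - W t ω) *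
        (a s + σ * ∫ u in (0 : ℝ)..s, W u ω * k (s - u))) ∂P = 0 := by
  obtain ⟨A, hA⟩ := isCompact_Icc.exists_bound_of_continuousOn (s := Set.Icc 0 t) ha.continuousOn
  obtain ⟨K, hK⟩ := isCompact_Icc.exists_bound_of_continuousOn (s := Set.Icc 0 t) hk.continuousOn
  have hcI : ∀ ω, Continuous fun s => ∫ u in (0 : ℝ)..s, W u ω * k (s - u) := by
    intro ω
    refine intervalIntegral.continuous_parametric_intervalIntegral_of_continuous
      (f := fun s u => W u ω * k (s - u)) ?_ continuous_id
    exact ((hW.continuous ω).comp continuous_snd).mul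
      (hk.comp (continuous_fst.sub continuous_snd))
  have hmI : ∀ s, Measurable fun ω => ∫ u in (0 : ℝ)..s, W u ω * k (s - u) := by
    intro s
    have h1 : Measurable (Function.uncurry fun u ω => W u ω * k (s - u)) :=
      measurable_uncurry_of_continuous_of_measurable
        (fun ω => (hW.continuous ω).mul (hk.comp (continuous_const.sub continuous_id)))
        fun u => (hW.measurable u).mul_const _
    have h2 : Measurable fun z : Ω × ℝ => W z.2 z.1 * k (s - z.2) := h1.comp measurable_swap
    unfold intervalIntegral
    exact (h2.stronglyMeasurable.integral_prod_right' (ν := volume.restrict (Set.Ioc 0 s))).sub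
      (h2.stronglyMeasurable.integral_prod_right' (ν := volume.restrict (Set.Ioc s 0)))
      |>.measurable
  have hsplit : ∀ s ω, (W s ω - W t ω) * (a s + σ * ∫ u in (0 : ℝ)..s, W u ω * k (s - u))
      = (W s ω - W t ω) * a s
        + σ * ∫ u in (0 : ℝ)..s, (W s ω - W t ω) * W u ω * k (s - u) := by
    intro s ω
    simp only [mul_assoc, intervalIntegral.integral_const_mul]
    ring
  have hp := fun s (hs : s ∈ Set.Icc 0 t) =>
    hW.integral_increment_mul_primitive hk hs.1 hs.2 (K := K) fun r hr => hK r hr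
  have hi1 : ∀ s ∈ Set.Icc 0 t, Integrable (fun ω => W s ω - W t ω) P := fun s hs =>
    (hW.integrable s hs.1).sub (hW.integrable t ht)
  have hmain := integral_intervalIntegral_eq_zero (P := P)
    (F := fun s ω => (W s ω - W t ω) * (a s + σ * ∫ u in (0 : ℝ)..s, W u ω * k (s - u)))
    (fun ω => ((hW.continuous ω).sub continuous_const).mul
      (ha.add (continuous_const.mul (hcI ω))))
    (fun s => ((hW.measurable s).sub (hW.measurable t)).mul
      (((hmI s).const_mul σ).const_add (a s))) ht
    (K := (1 + 2 * t) * A + |σ| * (K * (3 * t) * t))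
    (fun s hs => ?_) (fun s hs => ?_) (fun s hs => ?_)
  · exact ⟨hmain.1, hmain.2.1⟩
  · simp only [hsplit]
    exact ((hi1 s hs).mul_const _).add ((hp s hs).1.const_mul σ)
  · have hs1 : Integrable (fun ω => 1 + W s ω ^ 2) P :=
      (integrable_const 1).add (hW.integrable_sq hs.1)
    have h1 : ∫ ω, |W s ω - W t ω| ∂P ≤ 1 + 2 * t := by
      calc ∫ ω, |W s ω - W t ω| ∂P ≤ ∫ ω, (1 + W s ω ^ 2 + W t ω ^ 2) ∂P := by
            refine integral_mono (hi1 s hs).abs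
              (hs1.add (hW.integrable_sq ht)) fun ω => abs_le.2 ⟨?_, ?_⟩
            · nlinarith [sq_nonneg (W s ω + 1 / 2), sq_nonneg (W t ω - 1 / 2)]
            · nlinarith [sq_nonneg (W s ω - 1 / 2), sq_nonneg (W t ω + 1 / 2)]
        _ = 1 + s + t := by
            rw [integral_add hs1 (hW.integrable_sq ht),
              integral_add (integrable_const 1) (hW.integrable_sq hs.1),
              hW.integral_sq hs.1, hW.integral_sq ht]
            simp
        _ ≤ 1 + 2 * t := by linarith [hs.2]
    have hA' : |a s| ≤ A := hA s hs
    have hK0 : 0 ≤ K := (norm_nonneg _).trans (hK s hs)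
    have h2 : Integrable (fun ω => |W s ω - W t ω| * |a s|) P := (hi1 s hs).abs.mul_const _
    have h3 := (hp s hs).1.abs.const_mul |σ|
    simp only [hsplit]
    calc ∫ ω, |(W s ω - W t ω) * a s
          + σ * ∫ u in (0 : ℝ)..s, (W s ω - W t ω) * W u ω * k (s - u)| ∂P
        ≤ ∫ ω, (|W s ω - W t ω| * |a s|
          + |σ| * |∫ u in (0 : ℝ)..s, (W s ω - W t ω) * W u ω * k (s - u)|) ∂P := by
          refine integral_mono (((hi1 s hs).mul_const _).add ((hp s hs).1.const_mul σ)).abs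
            (h2.add h3) fun ω => ?_
          simp only [← abs_mul]
          exact abs_add_le _ _
      _ = (∫ ω, |W s ω - W t ω| ∂P) * |a s|
          + |σ| * ∫ ω, |∫ u in (0 : ℝ)..s, (W s ω - W t ω) * W u ω * k (s - u)| ∂P := by
          rw [integral_add h2 h3, integral_mul_const, integral_const_mul]
      _ ≤ (1 + 2 * t) * A + |σ| * (K * (3 * t) * t) := by
          refine add_le_add (mul_le_mul h1 hA' (abs_nonneg _) (by linarith))
            (mul_le_mul_of_nonneg_left ((hp s hs).2.2.trans ?_) (abs_nonneg _))
          exact mul_le_mul_of_nonneg_left hs.2 (by positivity)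
  · simp only [hsplit]
    rw [integral_add ((hi1 s hs).mul_const _) ((hp s hs).1.const_mul σ), integral_mul_const,
      integral_sub (hW.integrable s hs.1) (hW.integrable t ht), hW.integral_eq s hs.1,
      hW.integral_eq t ht, integral_const_mul, (hp s hs).2.1]
    simp

end IsBrownianCovariance

/-- A Brownian motion agrees almost surely, for all times at once, with a process all of whose
paths are continuous and whose values are measurable. Times `s < 0` carry the value at `0`. -/
theorem exists_isBrownianCovariance {Ω : Type*} [MeasurableSpace Ω] {P : Measure Ω}
    [IsProbabilityMeasure P] {w : ℝ≥0 → Ω → ℝ} (hw : IsBrownianReal w P) :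
    ∃ W : ℝ → Ω → ℝ, IsBrownianCovariance W P ∧ ∀ᵐ ω ∂P, ∀ s, W s ω = w s.toNNReal ω := by
  have hae := hw.toIsPreBrownianReal.aemeasurable
  have h1 : ∀ᵐ ω ∂P, Continuous (fun s => w s ω) ∧
      ∀ q : ℚ, w (q : ℝ).toNNReal ω = (hae (q : ℝ).toNNReal).mk _ ω := by
    filter_upwards [hw.cont, ae_all_iff.2 fun q : ℚ => (hae (q : ℝ).toNNReal).ae_eq_mk]
      with ω h2 h3 using ⟨h2, h3⟩
  obtain ⟨S, hSae, hS, hSprop⟩ := h1.exists_measurable_mem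
  let W : ℝ → Ω → ℝ := fun s => S.indicator (w s.toNNReal)
  have hWc : ∀ ω, Continuous fun s => W s ω := by
    intro ω
    by_cases hω : ω ∈ S
    · simp only [W, Set.indicator_of_mem hω]
      exact (hSprop ω hω).1.comp continuous_real_toNNReal
    · simp only [W, Set.indicator_of_notMem hω]
      exact continuous_const
  have hWq : ∀ q : ℚ, Measurable (W q) := by
    intro q
    have h2 : W q = S.indicator ((hae (q : ℝ).toNNReal).mk _) :=
      Set.indicator_congr fun ω hω => (hSprop ω hω).2 q
    rw [h2]
    exact (hae _).measurable_mk.indicator hS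
  have hWm : ∀ s, Measurable (W s) := by
    intro s
    obtain ⟨r, -, -, hr⟩ := Real.exists_seq_rat_strictMono_tendsto s
    exact measurable_of_tendsto_metrizable (fun i => hWq (r i))
      (tendsto_pi_nhds.2 fun ω => ((hWc ω).tendsto s).comp hr)
  have hWae : ∀ᵐ ω ∂P, ∀ s, W s ω = w s.toNNReal ω := by
    filter_upwards [hSae] with ω hω s
    exact Set.indicator_of_mem hω _
  have hWae' : ∀ s, w s.toNNReal =ᵐ[P] W s := fun s => hWae.mono fun ω h => (h s).symm
  have hL2 : ∀ s : ℝ≥0, MemLp (w s) 2 P := fun s =>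
    (hw.toIsPreBrownianReal.isGaussianProcess.hasGaussianLaw_eval s).memLp_two
  refine ⟨W, ⟨hWm, hWc, fun s _ => ?_, fun s t _ _ => ?_, fun s _ => ?_, fun s t hs ht => ?_⟩, hWae⟩
  · exact (hw.toIsPreBrownianReal.integrable_eval _).congr (hWae' s)
  · exact ((hL2 s.toNNReal).integrable_mul (hL2 t.toNNReal)).congr ((hWae' s).mul (hWae' t))
  · rw [← integral_congr_ae (hWae' s)]
    exact hw.toIsPreBrownianReal.integral_eval _
  · have h2 := hw.toIsPreBrownianReal.covariance_eval s.toNNReal t.toNNReal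
    rw [covariance_eq_sub (hL2 _) (hL2 _), hw.toIsPreBrownianReal.integral_eval, zero_mul,
      sub_zero] at h2
    refine (integral_congr_ae ((hWae' s).mul (hWae' t))).symm.trans (h2.trans ?_)
    rw [NNReal.coe_min, Real.coe_toNNReal _ hs, Real.coe_toNNReal _ ht]

/-- Without damping the mean energy grows exactly linearly. -/
theorem integral_energy_eq {n : Fin N} {σ : ℝ} {V : Matrix (Fin N) (Fin N) ℝ}
    (hV : V.IsSymm) {ψ₀ : Phase N} {Ω : Type*} [MeasurableSpace Ω] {P : Measure Ω}
    [IsProbabilityMeasure P] {w : ℝ≥0 → Ω → ℝ} {ψ : ℝ≥0 → Ω → Phase N}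
    (hw : IsBrownianReal w P) (hψ : IsSolution P V n 0 σ w ψ₀ ψ) (t : ℝ≥0) :
    Integrable (fun ω => energy V (ψ t ω)) P ∧
      ∫ ω, energy V (ψ t ω) ∂P = energy V ψ₀ + σ ^ 2 / 2 * t := by
  obtain ⟨W, hW, hWw⟩ := exists_isBrownianCovariance hw
  have ht : (0 : ℝ) ≤ t := t.2
  obtain ⟨hZi, hZ0⟩ := hW.integral_increment_mul_force
    (continuous_force_act_exp V n ψ₀) (continuous_kernel V n) σ ht
  set Z : Ω → ℝ := fun ω => ∫ s in (0 : ℝ)..t, (W s ω - W t ω) *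
    (force V n (act (NormedSpace.exp (s • drift V n 0)) ψ₀)
      + σ * ∫ u in (0 : ℝ)..s, W u ω * kernel V n (s - u)) with hZ
  have hpath : (fun ω => energy V ψ₀ + σ * Z ω + σ * ψ₀ (Sum.inr n) * W t ω
      + σ ^ 2 / 2 * W t ω ^ 2) =ᵐ[P] fun ω => energy V (ψ t ω) := by
    filter_upwards [hWw, hψ.continuous, hψ.equation] with ω h1 h2 h3
    have h4 := energy_eq_of_integral_eq hV n (σ := σ) (ψ₀ := ψ₀)
      (y := fun s => ψ s.toNNReal ω) (b := fun s => W s ω)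
      (h2.comp continuous_real_toNNReal) (hW.continuous ω) (fun s hs => by
        have h5 := h3 s.toNNReal
        rw [Real.coe_toNNReal _ hs] at h5
        rw [h1 s]
        exact h5) ht
    simp only [Real.toNNReal_coe] at h4
    rw [h4]
    ring
  have hi1 : Integrable (fun ω => energy V ψ₀ + σ * Z ω) P :=
    (integrable_const _).add (hZi.const_mul σ)
  have hi2 : Integrable (fun ω => σ * ψ₀ (Sum.inr n) * W t ω) P :=
    (hW.integrable t ht).const_mul _
  have hi3 : Integrable (fun ω => σ ^ 2 / 2 * W t ω ^ 2) P :=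
    (hW.integrable_sq ht).const_mul _
  have hi12 : Integrable (fun ω => energy V ψ₀ + σ * Z ω + σ * ψ₀ (Sum.inr n) * W t ω) P :=
    hi1.add hi2
  refine ⟨(hi12.add hi3).congr hpath, ?_⟩
  rw [← integral_congr_ae hpath, integral_add hi12 hi3, integral_add hi1 hi2,
    integral_add (integrable_const _) (hZi.const_mul σ), integral_const_mul, integral_const_mul,
    integral_const_mul, hZ0, hW.integral_eq t ht, hW.integral_sq ht]
  simp

end LinHam

end

theorem theorem2 (N : ℕ) (n : Fin N) :
    -- the exceptional set is the zero set of the nonzero polynomial `det (V^k e_n)_k`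
    -- in the entries `V(i,j)`, `i ≤ j`
    (∃ p : MvPolynomial (LinHam.UpperIdx N) ℝ, p ≠ 0 ∧
      (∀ V : LinHam.HN N, MvPolynomial.eval (LinHam.chart V) p = (LinHam.krylov V.1 n).det) ∧
      ∀ α : ℝ, 0 < α →
        LinHam.HPlus n α = {V : LinHam.HN N | MvPolynomial.eval (LinHam.chart V) p = 0}) ∧
    -- it is null for every absolutely continuous probability measure
    (∀ α : ℝ, 0 < α → ∀ μ : Measure (LinHam.HN N), IsProbabilityMeasure μ →
      LinHam.IsAbsCont μ → μ (LinHam.HPlus n α) = 0) ∧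
    -- linear growth of the mean energy for `α = 0`
    (∀ σ : ℝ, 0 < σ → ∀ V : Matrix (Fin N) (Fin N) ℝ, V.PosDef → ∀ ψ₀ : LinHam.Phase N,
      ∃ C : ℝ, ∀ (Ω : Type*) [MeasurableSpace Ω] (P : Measure Ω) [IsProbabilityMeasure P]
        (w : ℝ≥0 → Ω → ℝ) (ψ : ℝ≥0 → Ω → LinHam.Phase N),
        IsBrownianReal w P → LinHam.IsSolution P V n 0 σ w ψ₀ ψ →
        ∀ t : ℝ≥0, Integrable (fun ω => LinHam.energy V (ψ t ω)) P ∧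
          |(∫ ω, LinHam.energy V (ψ t ω) ∂P) - σ ^ 2 / 2 * (t : ℝ)| ≤ C) := by
  refine ⟨⟨LinHam.krylovPoly n, LinHam.krylovPoly_ne_zero n, LinHam.eval_chart_krylovPoly n,
    fun α hα => LinHam.HPlus_eq n hα⟩,
    fun α hα μ _ hμ => LinHam.measure_HPlus_eq_zero n hα hμ,
    fun σ _ V hV ψ₀ => ⟨|LinHam.energy V ψ₀|, ?_⟩⟩
  intro Ω _ P _ w ψ hw hψ t
  have hsymm : V.IsSymm := by simpa [Matrix.IsHermitian, Matrix.IsSymm] using hV.isHermitian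
  obtain ⟨h1, h2⟩ := LinHam.integral_energy_eq hsymm hw hψ t
  exact ⟨h1, by rw [h2, add_sub_cancel_right]⟩
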